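/- Let $G$ be a finite connected simple graph with vertex set $[d]$ and edge set $E(G)$. For an edge $e=\{i,j\}$ put $\rho(e)=\mathbf e_i+\mathbf e_j\in\mathbb R^d$, and let $\mathcal P_G=\operatorname{conv}\{\rho(e): e\in E(G)\}$ be the edge polytope of $G$. Let $\mathcal H=\{x\in\mathbb R^d:\sum_i a_ix_i=b\}$, with $0\neq a\in\mathbb R^d$ and $b\in\mathbb R$, be a separating hyperplane of $\mathcal P_G$: that is, $\mathcal H$ meets the relative interior of $\mathcal P_G$, and both polytopes $\mathcal P_G\cap\mathcal H^{(+)}$ and $\mathcal P_G\cap\mathcal H^{(-)}$ are integral (all their vertices have integer coordinates), where $\mathcal H^{(+)}=\{\sum_i a_ix_i\ge b\}$ and $\mathcal H^{(-)}=\{\sum_i a_ix_i\le b\}$. Let $G_+$ and $G_-$ be the spanning subgraphs of $G$ whose edges are the edges $e$ of $G$ with $\rho(e)\in\mathcal H^{(+)}$ and $\rho(e)\in\mathcal H^{(-)}$, respectively (so that $\mathcal P_{G_\pm}=\mathcal P_G\cap\mathcal H^{(\pm)}$ and $\mathcal P_G=\mathcal P_{G_+}\cup\mathcal P_{G_-}$).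 Let $K$ be a field. For a simple graph $\Gamma$ on $[d]$, the toric ideal $I_\Gamma$ is the kernel of the $K$-algebra homomorphism $K[x_e: e\in E(\Gamma)]\to K[t_1,\dots,t_d]$ that sends $x_e$ to $t_it_j$ for $e=\{i,j\}$. A quadratic binomial is a difference of two distinct monomials of degree $2$; the zero ideal counts as generated by the empty set of binomials. If $I_{G_+}$ and $I_{G_-}$ are both generated by quadratic binomials, then $I_G$ is generated by quadratic binomials. -/

import Mathlib

namespace EdgePolytope

open MvPolynomial

/-- The vector `ρ(e) = 𝐞ᵢ + 𝐞ⱼ` of `ℝ^V` attached to the pair `e = {i, j}`. -/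
def edgeVector {V : Type*} [DecidableEq V] (e : Sym2 V) : V → ℝ :=
  Sym2.lift ⟨fun i j => Pi.single i 1 + Pi.single j 1, fun _ _ => add_comm _ _⟩ e

/-- The edge polytope of `G`: the convex hull of the vectors `ρ(e)`, `e` an edge of `G`. -/
def edgePolytope {V : Type*} [DecidableEq V] (G : SimpleGraph V) : Set (V → ℝ) :=
  convexHull ℝ (edgeVector '' G.edgeSet)

/-- The set of points with `∑ aᵢ xᵢ = b`; a hyperplane when `a ≠ 0`. -/
def hyperplane {V : Type*} [Fintype V] (a : V → ℝ) (b : ℝ) : Set (V → ℝ) :=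
  {x | ∑ i, a i * x i = b}

/-- The closed half-space `∑ aᵢ xᵢ ≥ b`. -/
def posHalfSpace {V : Type*} [Fintype V] (a : V → ℝ) (b : ℝ) : Set (V → ℝ) :=
  {x | b ≤ ∑ i, a i * x i}

/-- The closed half-space `∑ aᵢ xᵢ ≤ b`. -/
def negHalfSpace {V : Type*} [Fintype V] (a : V → ℝ) (b : ℝ) : Set (V → ℝ) :=
  {x | ∑ i, a i * x i ≤ b}

/-- A polytope is integral if all its vertices (extreme points) have integer coordinates. -/
def IsIntegralPolytope {V : Type*} (P : Set (V → ℝ)) : Prop :=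
  ∀ x ∈ P.extremePoints ℝ, ∀ i, ∃ n : ℤ, x i = n

/-- `∑ aᵢ xᵢ = b` defines a separating hyperplane of the polytope `P`: it is a hyperplane that
meets the (relative) interior of `P` and cuts `P` into two integral polytopes. -/
structure IsSeparatingHyperplane {V : Type*} [Fintype V] (P : Set (V → ℝ))
    (a : V → ℝ) (b : ℝ) : Prop where
  ne_zero : a ≠ 0
  meets_interior : (hyperplane a b ∩ intrinsicInterior ℝ P).Nonempty
  integral_pos : IsIntegralPolytope (P ∩ posHalfSpace a b)
  integral_neg : IsIntegralPolytope (P ∩ negHalfSpace a b)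

/-- The spanning subgraph `G₊` of the edges `e` of `G` with `ρ(e)` in the half-space
`∑ aᵢ xᵢ ≥ b`. -/
def posSubgraph {V : Type*} [Fintype V] [DecidableEq V] (G : SimpleGraph V)
    (a : V → ℝ) (b : ℝ) : SimpleGraph V where
  Adj i j := G.Adj i j ∧ edgeVector s(i, j) ∈ posHalfSpace a b
  symm := ⟨fun i j h => ⟨h.1.symm, Sym2.eq_swap (a := i) (b := j) ▸ h.2⟩⟩
  loopless := ⟨fun i h => G.loopless.irrefl i h.1⟩

/-- The spanning subgraph `G₋` of the edges `e` of `G` with `ρ(e)` in the half-space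
`∑ aᵢ xᵢ ≤ b`. -/
def negSubgraph {V : Type*} [Fintype V] [DecidableEq V] (G : SimpleGraph V)
    (a : V → ℝ) (b : ℝ) : SimpleGraph V where
  Adj i j := G.Adj i j ∧ edgeVector s(i, j) ∈ negHalfSpace a b
  symm := ⟨fun i j h => ⟨h.1.symm, Sym2.eq_swap (a := i) (b := j) ▸ h.2⟩⟩
  loopless := ⟨fun i h => G.loopless.irrefl i h.1⟩

/-- The monomial `𝐭^e = tᵢ tⱼ` attached to the pair `e = {i, j}`. -/
noncomputable def edgeMonomial (K : Type*) [Field K] {V : Type*} (e : Sym2 V) :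
    MvPolynomial V K :=
  Sym2.lift ⟨fun i j => X i * X j, fun _ _ => mul_comm _ _⟩ e

/-- The `K`-algebra homomorphism `K[x_e : e ∈ E(G)] → K[t_v : v ∈ V]`, `x_e ↦ 𝐭^e`, whose image
is the edge ring `K[G]`. -/
noncomputable def edgeRingHom (K : Type*) [Field K] {V : Type*} (G : SimpleGraph V) :
    MvPolynomial G.edgeSet K →ₐ[K] MvPolynomial V K :=
  aeval fun e => edgeMonomial K (e : Sym2 V)

/-- The toric ideal `I_G`. -/
noncomputable def toricIdeal (K : Type*) [Field K] {V : Type*} (G : SimpleGraph V) :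
    Ideal (MvPolynomial G.edgeSet K) :=
  RingHom.ker (edgeRingHom K G)

/-- A quadratic binomial: a difference of two distinct monomials of degree two. -/
def IsQuadraticBinomial {K : Type*} [Field K] {σ : Type*} (f : MvPolynomial σ K) : Prop :=
  ∃ u v : σ →₀ ℕ, u ≠ v ∧ u.degree = 2 ∧ v.degree = 2 ∧ f = monomial u 1 - monomial v 1

/-- `G` is quadratic over `K`: its toric ideal is generated by quadratic binomials
(the zero ideal is generated by the empty set). -/
def IsQuadratic (K : Type*) [Field K] {V : Type*} (G : SimpleGraph V) : Prop :=
  ∃ S : Set (MvPolynomial G.edgeSet K),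
    (∀ f ∈ S, IsQuadraticBinomial f) ∧ toricIdeal K G = Ideal.span S

end EdgePolytope

namespace EdgePolytope

open MvPolynomial

/-! ### Edges of strictly opposite sign and faces of the edge polytope -/

section Geometry

variable {V : Type*} [DecidableEq V]

/-! Give the edge `ij` the weight `a i + a j - b`, so that the two subgraphs consist of the edges of
nonnegative and of nonpositive weight. If two edges of strictly opposite sign spanned a face of the
edge polytope, the hyperplane would cut that segment in a vertex of the positive part having a
coordinate strictly between 0 and 1, against integrality. Suitable functionals exhibit such a face
unless the edges are opposite in a four-cycle, whose other two edges then have weight zero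
(`exists_exchange`).

Each such four-cycle is a quadratic binomial of the toric ideal. Exchanging along them makes any
monomial congruent to one supported in a single subgraph (`exists_congruent_monomial`). Monomials
with equal image have equal total weight, so two reduced ones lie in a common subgraph, whose ideal
is quadratic by hypothesis (`isQuadratic_of_exchange`). -/

theorem sum_mul_edgeVector [Fintype V] (c : V → ℝ) (i j : V) :
    ∑ v, c v * edgeVector s(i, j) v = c i + c j := by
  simp [edgeVector, mul_add, Finset.sum_add_distrib, Pi.single_apply]

/-- The face of a convex hull on which a linear functional is maximal is a segment if only two of
the generators attain the maximum. -/
theorem mem_segment_of_mem_convexHull {E : Type*} [AddCommGroup E] [Module ℝ E] {S : Set E}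
    {φ : E →ₗ[ℝ] ℝ} {p q x : E} {M : ℝ} (hp : φ p = M) (hq : φ q = M)
    (h : ∀ s ∈ S, s ≠ p → s ≠ q → φ s < M) (hx : x ∈ convexHull ℝ S) :
    φ x ≤ M ∧ (φ x = M → x ∈ segment ℝ p q) := by
  have hseg : ∀ y ∈ segment ℝ p q, φ y = M := by
    rintro y ⟨s, t, -, -, hst, rfl⟩
    simp only [map_add, map_smul, hp, hq, smul_eq_mul, ← add_mul, hst, one_mul]
  have hle : ∀ y, (φ y < M ∨ y ∈ segment ℝ p q) → φ y ≤ M := fun y hy =>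
    hy.elim le_of_lt fun hy => (hseg y hy).le
  have hconv : Convex ℝ {y | φ y < M ∨ y ∈ segment ℝ p q} := by
    rw [convex_iff_forall_pos]
    intro y hy z hz s t hs ht hst
    have hy' := hle y hy
    have hz' := hle z hz
    have hM : s * M + t * M = M := by rw [← add_mul, hst, one_mul]
    by_cases hb : y ∈ segment ℝ p q ∧ z ∈ segment ℝ p q
    · exact Or.inr (convex_segment p q hb.1 hb.2 hs.le ht.le hst)
    · left
      simp only [map_add, map_smul, smul_eq_mul]
      rcases hy with hy | hy
      · have := mul_lt_mul_of_pos_left hy hs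
        have := mul_le_mul_of_nonneg_left hz' ht.le
        linarith
      · rcases hz with hz | hz
        · have := mul_lt_mul_of_pos_left hz ht
          have := mul_le_mul_of_nonneg_left hy' hs.le
          linarith
        · exact absurd ⟨hy, hz⟩ hb
  have hsub : S ⊆ {y | φ y < M ∨ y ∈ segment ℝ p q} := by
    intro s hs
    by_cases h1 : s = p
    · exact Or.inr (h1 ▸ left_mem_segment ℝ p q)
    by_cases h2 : s = q
    · exact Or.inr (h2 ▸ right_mem_segment ℝ p q)
    exact Or.inl (h s hs h1 h2)
  have hx' := convexHull_min hsub hconv hx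
  exact ⟨hle x hx', fun hM => hx'.resolve_left hM.not_lt⟩

/-- The linear functional `x ↦ ∑ cᵢ xᵢ`. -/
def dotFunctional [Fintype V] (c : V → ℝ) : (V → ℝ) →ₗ[ℝ] ℝ where
  toFun x := ∑ i, c i * x i
  map_add' x y := by simp [mul_add, Finset.sum_add_distrib]
  map_smul' t x := by simp [Finset.mul_sum, mul_left_comm]

/-- Any point where a hyperplane crosses the interior of a segment that is a face of `P` is a
vertex of the part of `P` on one side of the hyperplane. -/
theorem mem_extremePoints_of_face {E : Type*} [AddCommGroup E] [Module ℝ E] {P : Set E}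
    {φ ψ : E →ₗ[ℝ] ℝ} {p q : E} {M b s t : ℝ}
    (hP : ∀ x ∈ P, φ x ≤ M ∧ (φ x = M → x ∈ segment ℝ p q))
    (hp : φ p = M) (hq : φ q = M) (hpq : ψ p ≠ ψ q) (hst : s + t = 1)
    (hmem : s • p + t • q ∈ P) (hb : ψ (s • p + t • q) = b) :
    s • p + t • q ∈ (P ∩ {x | b ≤ ψ x}).extremePoints ℝ := by
  rw [mem_extremePoints]
  refine ⟨⟨hmem, hb.ge⟩, ?_⟩
  have hval : φ (s • p + t • q) = M := by
    simp only [map_add, map_smul, hp, hq, smul_eq_mul, ← add_mul, hst, one_mul]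
  -- `ψ` is affine and nonconstant along the segment, so it takes the value `b` there only once.
  have key : ∀ y ∈ segment ℝ p q, ψ y = b → y = s • p + t • q := by
    rintro y ⟨s', t', -, -, hst', rfl⟩ hy
    have h1 : (s' - s) * (ψ p - ψ q) = 0 := by
      simp only [map_add, map_smul, smul_eq_mul] at hy hb
      have ht : t = 1 - s := by linarith
      have ht' : t' = 1 - s' := by linarith
      subst ht ht'
      linarith
    have h2 : s' = s := by
      rcases mul_eq_zero.1 h1 with h | h
      · linarith
      · exact absurd (sub_eq_zero.1 h) hpq
    have h3 : t' = t := by linarith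
    rw [h2, h3]
  rintro y ⟨hyP, hyb⟩ z ⟨hzP, hzb⟩ ⟨α, β, hα, hβ, hαβ, hx⟩
  obtain ⟨hy1, hy2⟩ := hP y hyP
  obtain ⟨hz1, hz2⟩ := hP z hzP
  simp only [Set.mem_ofPred_eq] at hyb hzb
  have hφ : α * φ y + β * φ z = M := by rw [← hval, ← hx]; simp
  have hψ : α * ψ y + β * ψ z = b := by rw [← hb, ← hx]; simp
  have hβ' : β = 1 - α := by linarith
  -- A proper average of values on one side of a bound attains it only if both values do.
  have a1 : φ y = M := by
    by_contra h
    have := mul_lt_mul_of_pos_left (lt_of_le_of_ne hy1 h) hα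
    have := mul_le_mul_of_nonneg_left hz1 hβ.le
    subst hβ'; linarith
  have a2 : φ z = M := by
    by_contra h
    have := mul_lt_mul_of_pos_left (lt_of_le_of_ne hz1 h) hβ
    have := mul_le_mul_of_nonneg_left hy1 hα.le
    subst hβ'; linarith
  have b1 : ψ y = b := by
    by_contra h
    have := mul_lt_mul_of_pos_left (lt_of_le_of_ne hyb (Ne.symm h)) hα
    have := mul_le_mul_of_nonneg_left hzb hβ.le
    subst hβ'; linarith
  have b2 : ψ z = b := by
    by_contra h
    have := mul_lt_mul_of_pos_left (lt_of_le_of_ne hzb (Ne.symm h)) hβ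
    have := mul_le_mul_of_nonneg_left hyb hα.le
    subst hβ'; linarith
  exact ⟨key y (hy2 a1) b1, key z (hz2 a2) b2⟩

variable [Fintype V] {G : SimpleGraph V} {a : V → ℝ} {b : ℝ}

/-- If `ρ(ij)` and `ρ(kl)` span a face of the edge polytope, they are not separated strictly by
the hyperplane. -/
theorem weight_mul_nonneg_of_face
    (hint : IsIntegralPolytope (edgePolytope G ∩ posHalfSpace a b)) {i j k l : V}
    (hij : G.Adj i j) (hkl : G.Adj k l) (hik : i ≠ k) (hil : i ≠ l) (c : V → ℝ) {M : ℝ}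
    (hc₁ : c i + c j = M) (hc₂ : c k + c l = M)
    (hc : ∀ m n, G.Adj m n → s(m, n) ≠ s(i, j) → s(m, n) ≠ s(k, l) → c m + c n < M) :
    0 ≤ (a i + a j - b) * (a k + a l - b) := by
  by_contra hneg
  rw [not_le] at hneg
  set A := a i + a j - b with hA
  set B := a k + a l - b with hB
  have hAB : A ≠ B := by
    intro h
    rw [h] at hneg
    exact (mul_self_nonneg B).not_gt hneg
  have hd : A - B ≠ 0 := sub_ne_zero.2 hAB
  obtain ⟨s, t, hs, ht, hst, hcross⟩ :
      ∃ s t : ℝ, 0 < s ∧ 0 < t ∧ s + t = 1 ∧ s * A + t * B = 0 := by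
    -- These weights give the point of the segment whose `a`-value is `b`.
    refine ⟨-B / (A - B), A / (A - B), ?_, ?_, by field_simp; ring, by field_simp; ring⟩
    all_goals
      rcases mul_neg_iff.1 hneg with ⟨h1, h2⟩ | ⟨h1, h2⟩
      · apply div_pos <;> linarith
      · apply div_pos_of_neg_of_neg <;> linarith
  have hp : edgeVector s(i, j) ∈ edgePolytope G :=
    subset_convexHull ℝ _ ⟨_, hij, rfl⟩
  have hq : edgeVector s(k, l) ∈ edgePolytope G :=
    subset_convexHull ℝ _ ⟨_, hkl, rfl⟩
  have hface : ∀ x ∈ edgePolytope G, dotFunctional c x ≤ M ∧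
      (dotFunctional c x = M → x ∈ segment ℝ (edgeVector s(i, j)) (edgeVector s(k, l))) := by
    intro x hx
    refine mem_segment_of_mem_convexHull (S := edgeVector '' G.edgeSet)
      ((sum_mul_edgeVector c i j).trans hc₁) ((sum_mul_edgeVector c k l).trans hc₂) ?_ hx
    rintro _ ⟨e, he, rfl⟩ h1 h2
    induction e with
    | h m n =>
      refine (sum_mul_edgeVector c m n).trans_lt (hc m n he ?_ ?_)
      · exact fun h => h1 (by rw [h])
      · exact fun h => h2 (by rw [h])
  have hext := mem_extremePoints_of_face (ψ := dotFunctional a) (b := b) hface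
    ((sum_mul_edgeVector c i j).trans hc₁) ((sum_mul_edgeVector c k l).trans hc₂)
    (by
      change ∑ v, a v * edgeVector s(i, j) v ≠ ∑ v, a v * edgeVector s(k, l) v
      rw [sum_mul_edgeVector, sum_mul_edgeVector]
      intro h
      exact hAB (by rw [hA, hB, h]))
    hst (convex_convexHull ℝ _ hp hq hs.le ht.le hst)
    (by
      rw [map_add, map_smul, map_smul]
      change s * ∑ v, a v * edgeVector s(i, j) v + t * ∑ v, a v * edgeVector s(k, l) v = b
      rw [sum_mul_edgeVector, sum_mul_edgeVector]
      have : t = 1 - s := by linarith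
      subst this
      linarith)
  -- Since `i` is not an end of `kl`, the `i`-th coordinate of this vertex is `s`, strictly between
  -- 0 and 1.
  obtain ⟨n, hn⟩ := hint _ hext i
  have hval : (s • edgeVector s(i, j) + t • edgeVector s(k, l)) i = s := by
    simp [edgeVector, hik, hil, hij.ne]
  rw [hval] at hn
  have h0 : (0 : ℝ) < n := hn ▸ hs
  have h1 : (n : ℝ) < 1 := by linarith
  norm_cast at h0 h1
  omega

/-- Edges with a common vertex are not separated strictly. -/
theorem weight_mul_nonneg_of_common_vertex
    (hint : IsIntegralPolytope (edgePolytope G ∩ posHalfSpace a b)) {i j k : V}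
    (hij : G.Adj i j) (hik : G.Adj i k) :
    0 ≤ (a i + a j - b) * (a i + a k - b) := by
  by_cases hjk : j = k
  · subst hjk
    exact mul_self_nonneg _
  have hne := hij.ne
  have hne' := hik.ne
  have := weight_mul_nonneg_of_face hint hij.symm hik hij.ne' hjk
    -- Both edges have value 3; any other pair of distinct vertices has value at most 2.
    (fun v => if v = i then 2 else if v = j then 1 else if v = k then 1 else 0) (M := 3)
    (by simp [hne.symm]; norm_num) (by simp [hne'.symm, Ne.symm hjk]; norm_num) (by
      intro m n hmn h1 h2
      have := hmn.ne
      simp only [ne_eq, Sym2.eq_iff] at h1 h2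
      split_ifs <;> first | norm_num; done | (subst_vars; simp_all))
  rwa [add_comm (a j)] at this

/-- Disjoint edges `ij` and `kl` are not separated strictly if no edge joins `i` to `kl`. -/
theorem weight_mul_nonneg_of_not_adj
    (hint : IsIntegralPolytope (edgePolytope G ∩ posHalfSpace a b)) {i j k l : V}
    (hij : G.Adj i j) (hkl : G.Adj k l) (hik : i ≠ k) (hil : i ≠ l) (hjk : j ≠ k) (hjl : j ≠ l)
    (h₁ : ¬ G.Adj i k) (h₂ : ¬ G.Adj i l) :
    0 ≤ (a i + a j - b) * (a k + a l - b) := by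
  have hne := hij.ne
  have hne' := hkl.ne
  refine weight_mul_nonneg_of_face hint hij hkl hik hil
    -- Both edges have value 4. Only the pairs `ik` and `il` would exceed it, with 5, and they are
    -- not edges; all others give at most 3.
    (fun v => if v = i then 3 else if v = j then 1 else if v = k then 2 else
      if v = l then 2 else 0) (M := 4)
    (by simp [hne.symm]; norm_num)
    (by simp [hne'.symm, hik.symm, hil.symm, hjk.symm, hjl.symm]; norm_num) (by
      intro m n hmn h1 h2
      have := hmn.ne
      have h₁' : ¬ G.Adj k i := fun h => h₁ h.symm
      have h₂' : ¬ G.Adj l i := fun h => h₂ h.symm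
      simp only [ne_eq, Sym2.eq_iff] at h1 h2
      split_ifs <;> first | norm_num; done | (subst_vars; simp_all))

/-- Strictly separated edges are opposite edges of a four-cycle whose remaining edges lie on the
hyperplane. -/
theorem exists_exchange
    (hint : IsIntegralPolytope (edgePolytope G ∩ posHalfSpace a b)) {i j k l : V}
    (hij : G.Adj i j) (hkl : G.Adj k l) (hpos : 0 < a i + a j - b) (hneg : a k + a l - b < 0) :
    (G.Adj i k ∧ G.Adj j l ∧ a i + a k - b = 0 ∧ a j + a l - b = 0) ∨
    (G.Adj i l ∧ G.Adj j k ∧ a i + a l - b = 0 ∧ a j + a k - b = 0) := by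
  have hlt := mul_neg_of_pos_of_neg hpos hneg
  -- The edge `pr` meets both a positive and a negative edge, so its weight can be neither negative
  -- nor positive.
  have zero : ∀ {p q r s}, G.Adj p q → G.Adj r s → 0 < a p + a q - b → a r + a s - b < 0 →
      G.Adj p r → a p + a r - b = 0 := by
    intro p q r s hpq hrs hp hn hpr
    have h1 := weight_mul_nonneg_of_common_vertex hint hpq hpr
    have h2 := weight_mul_nonneg_of_common_vertex hint hrs hpr.symm
    rw [add_comm (a r) (a p)] at h2
    have h3 := nonneg_of_mul_nonneg_right h1 hp
    rcases h3.lt_or_eq with h | h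
    · exact absurd h2 (mul_neg_of_neg_of_pos hn h).not_ge
    · exact h.symm
  have hik : i ≠ k := by
    rintro rfl
    exact (weight_mul_nonneg_of_common_vertex hint hij hkl).not_gt hlt
  have hil : i ≠ l := by
    rintro rfl
    have := weight_mul_nonneg_of_common_vertex hint hij hkl.symm
    rw [add_comm (a i) (a k)] at this
    exact this.not_gt hlt
  have hjk : j ≠ k := by
    rintro rfl
    have := weight_mul_nonneg_of_common_vertex hint hij.symm hkl
    rw [add_comm (a j) (a i)] at this
    exact this.not_gt hlt
  have hjl : j ≠ l := by
    rintro rfl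
    have := weight_mul_nonneg_of_common_vertex hint hij.symm hkl.symm
    rw [add_comm (a j) (a i), add_comm (a j) (a k)] at this
    exact this.not_gt hlt
  have hpos' : 0 < a j + a i - b := by rwa [add_comm (a j)]
  have hneg' : a l + a k - b < 0 := by rwa [add_comm (a l)]
  by_cases c1 : G.Adj i k ∧ G.Adj j l
  · exact Or.inl ⟨c1.1, c1.2, zero hij hkl hpos hneg c1.1,
      zero hij.symm hkl.symm hpos' hneg' c1.2⟩
  by_cases c2 : G.Adj i l ∧ G.Adj j k
  · exact Or.inr ⟨c2.1, c2.2, zero hij hkl.symm hpos hneg' c2.1,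
      zero hij.symm hkl hpos' hneg c2.2⟩
  exfalso
  -- If both perfect matchings between the two edges fail, some endpoint has no neighbour on the
  -- opposite edge.
  rw [not_and_or] at c1 c2
  rcases c1 with c1 | c1 <;> rcases c2 with c2 | c2
  · exact (weight_mul_nonneg_of_not_adj hint hij hkl hik hil hjk hjl c1 c2).not_gt hlt
  · have := weight_mul_nonneg_of_not_adj hint hkl hij hik.symm hjk.symm hil.symm hjl.symm
      (fun h => c1 h.symm) (fun h => c2 h.symm)
    rw [mul_comm] at this
    exact this.not_gt hlt
  · have := weight_mul_nonneg_of_not_adj hint hkl.symm hij hil.symm hjl.symm hik.symm hjk.symm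
      (fun h => c2 h.symm) (fun h => c1 h.symm)
    rw [mul_comm, add_comm (a l)] at this
    exact this.not_gt hlt
  · have := weight_mul_nonneg_of_not_adj hint hij.symm hkl hjk hjl hik hil c2 c1
    rw [add_comm (a j)] at this
    exact this.not_gt hlt

end Geometry

/-! ### Toric ideals and reduction of monomials -/

section Algebra

variable {V : Type*}

/-- The exponent vector of `𝐭^e`. -/
noncomputable def edgeExponent (e : Sym2 V) : V →₀ ℕ :=
  Sym2.lift ⟨fun i j => Finsupp.single i 1 + Finsupp.single j 1, fun _ _ => add_comm _ _⟩ e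

theorem edgeMonomial_eq (K : Type*) [Field K] (e : Sym2 V) :
    edgeMonomial K e = monomial (edgeExponent e) 1 := by
  induction e with
  | h i j => simp [edgeMonomial, edgeExponent, X, monomial_mul]

/-- The exponent of the image of a monomial of `K[x_e]` in `K[t_v]`. -/
noncomputable def degreeVector (G : SimpleGraph V) : (G.edgeSet →₀ ℕ) →+ (V →₀ ℕ) :=
  Finsupp.weight fun e : G.edgeSet => edgeExponent (e : Sym2 V)

variable (K : Type*) [Field K]

theorem edgeRingHom_monomial (G : SimpleGraph V) (u : G.edgeSet →₀ ℕ) :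
    edgeRingHom K G (monomial u 1) = monomial (degreeVector G u) 1 := by
  simp only [edgeRingHom, aeval_monomial, map_one, one_mul, edgeMonomial_eq, degreeVector,
    Finsupp.weight_apply, Finsupp.sum, Finsupp.prod, monomial_pow, one_pow]
  exact (monomial_sum_one (R := K) _ _).symm

theorem monomial_sub_monomial_mem_toricIdeal_iff (G : SimpleGraph V) (u v : G.edgeSet →₀ ℕ) :
    monomial u (1 : K) - monomial v 1 ∈ toricIdeal K G ↔ degreeVector G u = degreeVector G v := by
  rw [toricIdeal, RingHom.mem_ker, map_sub, sub_eq_zero]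
  change edgeRingHom K G _ = edgeRingHom K G _ ↔ _
  rw [edgeRingHom_monomial, edgeRingHom_monomial, monomial_left_inj one_ne_zero]

/-- An ideal that contains all the binomials of the toric ideal contains the toric ideal. -/
theorem toricIdeal_le_of_binomials (G : SimpleGraph V) (J : Ideal (MvPolynomial G.edgeSet K))
    (hJ : ∀ u v, degreeVector G u = degreeVector G v →
      monomial u (1 : K) - monomial v 1 ∈ J) :
    toricIdeal K G ≤ J := by
  -- `sec` picks a representative in each nonempty fibre of `degreeVector`; modulo `J`, `ψ` undoes
  -- `edgeRingHom`.
  let sec : (V →₀ ℕ) → (G.edgeSet →₀ ℕ) := Function.invFun (degreeVector G)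
  let ψ : MvPolynomial V K →ₗ[K] MvPolynomial G.edgeSet K :=
    (basisMonomials V K).constr K fun w => monomial (sec w) 1
  have hψ : ∀ w, ψ (monomial w 1) = monomial (sec w) 1 := by
    intro w
    have := (basisMonomials V K).constr_basis K (fun w => monomial (sec w) (1 : K)) w
    rwa [coe_basisMonomials] at this
  have key : ∀ f, f - ψ (edgeRingHom K G f) ∈ J := by
    intro f
    induction f using MvPolynomial.induction_on' with
    | monomial u c =>
      have hc : monomial u c = c • monomial u (1 : K) := by simp [smul_monomial]
      rw [hc, map_smul, map_smul, edgeRingHom_monomial, hψ, ← smul_sub, smul_eq_C_mul]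
      exact J.mul_mem_left _ (hJ _ _ (Function.invFun_eq (f := degreeVector G) ⟨u, rfl⟩).symm)
    | add f g hf hg =>
      rw [map_add, map_add, add_sub_add_comm]
      exact J.add_mem hf hg
  intro f hf
  have hf' : edgeRingHom K G f = 0 := hf
  simpa [hf'] using key f

/-- The quadratic binomials in the toric ideal. -/
def quadraticBinomials (G : SimpleGraph V) : Set (MvPolynomial G.edgeSet K) :=
  {f | IsQuadraticBinomial f ∧ f ∈ toricIdeal K G}

variable {K}

/-- The inclusion of the edge set of a spanning subgraph. -/
def edgeInclusion {H G : SimpleGraph V} (h : H ≤ G) : H.edgeSet → G.edgeSet :=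
  Set.inclusion (SimpleGraph.edgeSet_mono h)

theorem edgeInclusion_injective {H G : SimpleGraph V} (h : H ≤ G) :
    Function.Injective (edgeInclusion h) :=
  Set.inclusion_injective (SimpleGraph.edgeSet_mono h)

theorem edgeRingHom_rename {H G : SimpleGraph V} (h : H ≤ G) (f : MvPolynomial H.edgeSet K) :
    edgeRingHom K G (rename (edgeInclusion h) f) = edgeRingHom K H f := by
  simp only [edgeRingHom, aeval_rename]
  rfl

/-- Renaming keeps quadratic binomials quadratic and commutes with the maps to `K[t]`, so it is
enough to move the generators. -/
theorem rename_mem_span {H G : SimpleGraph V} (h : H ≤ G) (hH : IsQuadratic K H)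
    {f : MvPolynomial H.edgeSet K} (hf : f ∈ toricIdeal K H) :
    rename (edgeInclusion h) f ∈ Ideal.span (quadraticBinomials K G) := by
  obtain ⟨S, hS, hspan⟩ := hH
  have hle : Ideal.span S ≤ (Ideal.span (quadraticBinomials K G)).comap
      (rename (R := K) (edgeInclusion h)) := by
    rw [Ideal.span_le]
    intro g hg
    refine Ideal.subset_span ⟨?_, ?_⟩
    · obtain ⟨u, v, huv, hu, hv, rfl⟩ := hS g hg
      refine ⟨u.mapDomain (edgeInclusion h), v.mapDomain (edgeInclusion h),
        fun huv' => huv (Finsupp.mapDomain_injective (edgeInclusion_injective h) huv'), ?_, ?_, ?_⟩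
      · rwa [Finsupp.degree_mapDomain]
      · rwa [Finsupp.degree_mapDomain]
      · simp [rename_monomial]
    · have hg' : edgeRingHom K H g = 0 := by
        have : g ∈ toricIdeal K H := hspan ▸ Ideal.subset_span hg
        exact this
      change edgeRingHom K G (rename (edgeInclusion h) g) = 0
      rw [edgeRingHom_rename, hg']
  exact hle (hspan ▸ hf)

theorem binomial_mem_span_of_subgraph {H G : SimpleGraph V} (h : H ≤ G) (hH : IsQuadratic K H)
    {u v : G.edgeSet →₀ ℕ} (hu : ∀ e ∈ u.support, (e : Sym2 V) ∈ H.edgeSet)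
    (hv : ∀ e ∈ v.support, (e : Sym2 V) ∈ H.edgeSet) (huv : degreeVector G u = degreeVector G v) :
    monomial u (1 : K) - monomial v 1 ∈ Ideal.span (quadraticBinomials K G) := by
  have lift : ∀ w : G.edgeSet →₀ ℕ, (∀ e ∈ w.support, (e : Sym2 V) ∈ H.edgeSet) →
      ∃ w', w = Finsupp.mapDomain (edgeInclusion h) w' := by
    intro w hw
    refine ⟨w.comapDomain (edgeInclusion h) (edgeInclusion_injective h).injOn, ?_⟩
    rw [Finsupp.mapDomain_comapDomain _ (edgeInclusion_injective h)]
    intro e he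
    exact ⟨⟨e, hw e he⟩, rfl⟩
  obtain ⟨u', rfl⟩ := lift u hu
  obtain ⟨v', rfl⟩ := lift v hv
  have hmem := (monomial_sub_monomial_mem_toricIdeal_iff K G _ _).2 huv
  have hren : rename (edgeInclusion h) (monomial u' (1 : K) - monomial v' 1) =
      monomial (u'.mapDomain (edgeInclusion h)) 1 - monomial (v'.mapDomain (edgeInclusion h)) 1 := by
    simp [rename_monomial]
  rw [← hren] at hmem ⊢
  refine rename_mem_span h hH ?_
  have h0 : edgeRingHom K G (rename (edgeInclusion h) (monomial u' 1 - monomial v' 1)) = 0 := hmem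
  rwa [edgeRingHom_rename] at h0

theorem exists_eq_single_add_single {σ : Type*} {u : σ →₀ ℕ} {e f : σ} (hef : e ≠ f)
    (he : e ∈ u.support) (hf : f ∈ u.support) :
    ∃ r, u = (Finsupp.single e 1 + Finsupp.single f 1) + r := by
  classical
  refine ⟨u - (Finsupp.single e 1 + Finsupp.single f 1), (add_tsub_cancel_of_le ?_).symm⟩
  intro g
  rw [Finsupp.mem_support_iff] at he hf
  simp only [Finsupp.add_apply, Finsupp.single_apply]
  split_ifs with h1 h2 h2
  · exact absurd (h1.trans h2.symm) hef
  · subst h1; omega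
  · subst h2; omega
  · omega

/-- Let `w` be a function on the edges of `G` such that every positive and every negative edge may
be exchanged for two edges of value zero. Then every monomial is congruent, modulo the quadratic
binomials of the toric ideal, to one without positive edges or without negative edges. -/
theorem exists_congruent_monomial {G : SimpleGraph V} (w : G.edgeSet → ℝ)
    (hw : ∀ e f, 0 < w e → w f < 0 → ∃ g h, w g = 0 ∧ w h = 0 ∧
      edgeExponent (e : Sym2 V) + edgeExponent (f : Sym2 V) =
        edgeExponent (g : Sym2 V) + edgeExponent (h : Sym2 V))
    (u : G.edgeSet →₀ ℕ) :
    ∃ v, degreeVector G v = degreeVector G u ∧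
      monomial u (1 : K) - monomial v 1 ∈ Ideal.span (quadraticBinomials K G) ∧
      ((∀ e ∈ v.support, 0 ≤ w e) ∨ ∀ e ∈ v.support, w e ≤ 0) := by
  classical
  -- `N` counts positive edges with multiplicity; each exchange lowers it by one.
  let N : (G.edgeSet →₀ ℕ) →+ ℕ := Finsupp.weight fun e => if 0 < w e then 1 else 0
  induction hn : N u using Nat.strong_induction_on generalizing u with
  | _ n ih =>
    by_cases hc : (∀ e ∈ u.support, 0 ≤ w e) ∨ ∀ e ∈ u.support, w e ≤ 0
    · exact ⟨u, rfl, by simp, hc⟩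
    push Not at hc
    obtain ⟨⟨f, hf, hwf⟩, e, he, hwe⟩ := hc
    obtain ⟨g, h, hg, hh, hex⟩ := hw e f hwe hwf
    have hef : e ≠ f := by rintro rfl; exact lt_asymm hwe hwf
    obtain ⟨r, rfl⟩ := exists_eq_single_add_single hef he hf
    set p : G.edgeSet →₀ ℕ := Finsupp.single e 1 + Finsupp.single f 1
    set q : G.edgeSet →₀ ℕ := Finsupp.single g 1 + Finsupp.single h 1
    have hNp : N p = 1 := by simp [N, p, Finsupp.weight_single, hwe, hwf.le]
    have hNq : N q = 0 := by simp [N, q, Finsupp.weight_single, hg, hh]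
    have hdeg : degreeVector G p = degreeVector G q := by
      simpa [degreeVector, p, q, Finsupp.weight_single] using hex
    have hpq : p ≠ q := by
      intro h
      rw [h, hNq] at hNp
      exact zero_ne_one hNp
    have hmem : monomial p (1 : K) - monomial q 1 ∈ Ideal.span (quadraticBinomials K G) := by
      refine Ideal.subset_span ⟨⟨p, q, hpq, ?_, ?_, rfl⟩,
        (monomial_sub_monomial_mem_toricIdeal_iff K G p q).2 hdeg⟩
      · simp [p, map_add]
      · simp [q, map_add]
    obtain ⟨v, hv1, hv2, hv3⟩ := ih (N (q + r)) (by
      rw [map_add] at hn ⊢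
      omega) (q + r) rfl
    refine ⟨v, ?_, ?_, hv3⟩
    · rw [hv1, map_add _ q, map_add _ p, hdeg]
    · have hmul := Ideal.mul_mem_right (monomial r (1 : K)) _ hmem
      rw [sub_mul, monomial_mul, monomial_mul, one_mul] at hmul
      have := Ideal.add_mem _ hmul hv2
      rwa [sub_add_sub_cancel] at this

/-- A linear functional on the exponents of `K[t_v]` takes on the image of a monomial the sum of
its values on the edges. -/
theorem weight_degreeVector {G : SimpleGraph V} (c : V → ℝ) (u : G.edgeSet →₀ ℕ) :
    Finsupp.weight c (degreeVector G u) =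
      u.sum fun e n => n • Finsupp.weight c (edgeExponent (e : Sym2 V)) := by
  rw [degreeVector, Finsupp.weight_apply _ u, map_finsuppSum]
  simp

/-- If every positive and every negative edge, for weights on the vertices, may be exchanged for
two edges of weight zero, and the subgraphs of the nonnegative and of the nonpositive edges are
quadratic, then the graph is quadratic. -/
theorem isQuadratic_of_exchange {G P N : SimpleGraph V} (c : V → ℝ) (hP : P ≤ G) (hN : N ≤ G)
    (hPmem : ∀ e ∈ G.edgeSet, 0 ≤ Finsupp.weight c (edgeExponent e) → e ∈ P.edgeSet)
    (hNmem : ∀ e ∈ G.edgeSet, Finsupp.weight c (edgeExponent e) ≤ 0 → e ∈ N.edgeSet)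
    (hex : ∀ e f : G.edgeSet, 0 < Finsupp.weight c (edgeExponent (e : Sym2 V)) →
      Finsupp.weight c (edgeExponent (f : Sym2 V)) < 0 →
      ∃ g h : G.edgeSet, Finsupp.weight c (edgeExponent (g : Sym2 V)) = 0 ∧
        Finsupp.weight c (edgeExponent (h : Sym2 V)) = 0 ∧
        edgeExponent (e : Sym2 V) + edgeExponent (f : Sym2 V) =
          edgeExponent (g : Sym2 V) + edgeExponent (h : Sym2 V))
    (hPq : IsQuadratic K P) (hNq : IsQuadratic K N) : IsQuadratic K G := by
  let w : G.edgeSet → ℝ := fun e => Finsupp.weight c (edgeExponent (e : Sym2 V))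
  refine ⟨quadraticBinomials K G, fun f hf => hf.1, le_antisymm ?_ ?_⟩
  swap
  · exact Ideal.span_le.2 fun f hf => hf.2
  refine toricIdeal_le_of_binomials K G _ fun u v huv => ?_
  obtain ⟨u', hu1, hu2, hu3⟩ := exists_congruent_monomial (K := K) w hex u
  obtain ⟨v', hv1, hv2, hv3⟩ := exists_congruent_monomial (K := K) w hex v
  have huv' : degreeVector G u' = degreeVector G v' := by rw [hu1, hv1, huv]
  suffices h : monomial u' (1 : K) - monomial v' 1 ∈ Ideal.span (quadraticBinomials K G) by
    have := Ideal.sub_mem _ (Ideal.add_mem _ hu2 h) hv2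
    convert this using 1
    ring
  -- The total weights are equal, one being nonnegative and the other nonpositive, so both vanish
  -- and every edge of `p` has weight zero.
  have mixed : ∀ {p q : G.edgeSet →₀ ℕ}, degreeVector G p = degreeVector G q →
      (∀ e ∈ p.support, 0 ≤ w e) → (∀ e ∈ q.support, w e ≤ 0) → ∀ e ∈ p.support, w e ≤ 0 := by
    intro p q hpq hp hq e he
    have hsum := congrArg (Finsupp.weight c) hpq
    rw [weight_degreeVector, weight_degreeVector] at hsum
    have hq' : (q.sum fun e n => n • w e) ≤ 0 :=
      Finset.sum_nonpos fun e he => smul_nonpos_of_nonneg_of_nonpos (Nat.zero_le _) (hq e he)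
    have hle : p e • w e ≤ p.sum fun e n => n • w e :=
      Finset.single_le_sum (f := fun e => p e • w e)
        (fun e he => smul_nonneg (Nat.zero_le _) (hp e he)) he
    have h0 : (p e : ℝ) * w e ≤ 0 := by
      rw [← nsmul_eq_mul]
      exact hle.trans (hsum.trans_le hq')
    have hpe : (0 : ℝ) < p e := by
      exact_mod_cast Nat.pos_of_ne_zero (Finsupp.mem_support_iff.1 he)
    exact nonpos_of_mul_nonpos_right h0 hpe
  have inP : ∀ {p : G.edgeSet →₀ ℕ}, (∀ e ∈ p.support, 0 ≤ w e) →
      ∀ e ∈ p.support, (e : Sym2 V) ∈ P.edgeSet := fun hp e he => hPmem e e.2 (hp e he)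
  have inN : ∀ {p : G.edgeSet →₀ ℕ}, (∀ e ∈ p.support, w e ≤ 0) →
      ∀ e ∈ p.support, (e : Sym2 V) ∈ N.edgeSet := fun hp e he => hNmem e e.2 (hp e he)
  rcases hu3 with hu3 | hu3 <;> rcases hv3 with hv3 | hv3
  · exact binomial_mem_span_of_subgraph hP hPq (inP hu3) (inP hv3) huv'
  · exact binomial_mem_span_of_subgraph hN hNq (inN (mixed huv' hu3 hv3)) (inN hv3) huv'
  · exact binomial_mem_span_of_subgraph hN hNq (inN hu3) (inN (mixed huv'.symm hv3 hu3)) huv'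
  · exact binomial_mem_span_of_subgraph hN hNq (inN hu3) (inN hv3) huv'

end Algebra

end EdgePolytope

open EdgePolytope in
theorem mainTheorem3 (K : Type*) [Field K] {V : Type*} [Fintype V] [DecidableEq V]
    (G : SimpleGraph V) (hG : G.Connected) (a : V → ℝ) (b : ℝ)
    (hH : EdgePolytope.IsSeparatingHyperplane (EdgePolytope.edgePolytope G) a b)
    (hpos : EdgePolytope.IsQuadratic K (EdgePolytope.posSubgraph G a b))
    (hneg : EdgePolytope.IsQuadratic K (EdgePolytope.negSubgraph G a b)) :
    EdgePolytope.IsQuadratic K G := by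
  -- Each edge has two endpoints, so subtracting `b / 2` at every vertex subtracts `b` from every
  -- edge.
  have hw : ∀ i j, Finsupp.weight (fun v => a v - b / 2) (edgeExponent s(i, j)) =
      a i + a j - b := by
    intro i j
    simp only [edgeExponent, Sym2.lift_mk, map_add, Finsupp.weight_single, one_smul]
    ring
  refine isQuadratic_of_exchange (P := posSubgraph G a b) (N := negSubgraph G a b)
    (fun v => a v - b / 2) (fun _ _ h => h.1) (fun _ _ h => h.1)
    ?_ ?_ ?_ hpos hneg
  · intro e he h
    induction e with
    | h i j =>
      rw [hw] at h
      refine ⟨he, ?_⟩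
      change b ≤ ∑ v, a v * edgeVector s(i, j) v
      rw [sum_mul_edgeVector]
      linarith
  · intro e he h
    induction e with
    | h i j =>
      rw [hw] at h
      refine ⟨he, ?_⟩
      change ∑ v, a v * edgeVector s(i, j) v ≤ b
      rw [sum_mul_edgeVector]
      linarith
  · rintro ⟨e, he⟩ ⟨f, hf⟩ h1 h2
    induction e with
    | h i j =>
      induction f with
      | h k l =>
        simp only [hw] at h1 h2
        rcases exists_exchange hH.integral_pos he hf h1 h2 with
          ⟨g1, g2, z1, z2⟩ | ⟨g1, g2, z1, z2⟩
        · refine ⟨⟨s(i, k), g1⟩, ⟨s(j, l), g2⟩, (hw _ _).trans z1, (hw _ _).trans z2, ?_⟩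
          simp only [edgeExponent, Sym2.lift_mk]
          abel
        · refine ⟨⟨s(i, l), g1⟩, ⟨s(j, k), g2⟩, (hw _ _).trans z1, (hw _ _).trans z2, ?_⟩
          simp only [edgeExponent, Sym2.lift_mk]
          abel
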